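/- Let $k$ be a commutative artinian ring, let $E$ be a minimal injective cogenerator of $k$, and put $D=\mathrm{Hom}_k(-,E)$. Let $\mathcal A$ be a Hom-finite $k$-linear abelian category (every $\mathrm{Hom}_{\mathcal A}(X,Y)$ is a finitely generated $k$-module). A morphism is *projectively trivial* if it factors through every epimorphism ending at its target, and *injectively trivial* if it factors through every monomorphism starting at its source. Write $\mathcal P$ and $\mathcal I$ for the ideals of projectively and injectively trivial morphisms, and put $\underline{\mathcal A}=\mathcal A/\mathcal P$ and $\overline{\mathcal A}=\mathcal A/\mathcal I$, with Hom groups $\underline{\mathrm{Hom}}_{\mathcal A}$ and $\overline{\mathrm{Hom}}_{\mathcal A}$. Assume that $\mathcal A$ has Auslander–Reiten duality: there are a $k$-linear equivalence $\tau\colon\underline{\mathcal A}\to\overline{\mathcal A}$ and $k$-linear isomorphisms $$D\,\mathrm{Ext}^1_{\mathcal A}(X,Y)\;\cong\;\overline{\mathrm{Hom}}_{\mathcal A}(Y,\tau X)$$ natural in $X$ and $Y$. Let $K,Y$ be objects of $\mathcal A$, let $\tau^{-1}$ be a quasi-inverse of $\tau$, and let $C$ be an object of $\mathcal A$ isomorphic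 to $\tau^{-1}K$ in $\underline{\mathcal A}$ (for instance $C=\tau^{-1}K$). Write $\Gamma(K)=\mathrm{End}_{\mathcal A}(K)$ and $\Gamma(C)=\mathrm{End}_{\mathcal A}(C)$, and let $\mathrm{add}\,K$ be the class of direct summands of finite direct sums of copies of $K$. A morphism $\alpha\colon X\to Y$ is *right minimal* if every endomorphism $u$ of $X$ with $\alpha\circ u=\alpha$ is an automorphism; right minimality of a homomorphism of modules is defined in the same way. It is *right $C$-determined* if every $t\colon T\to Y$ such that $t\circ\phi$ factors through $\alpha$ for all $\phi\colon C\to T$ itself factors through $\alpha$. Two epimorphisms to $Y$ are *right equivalent* if each factors through the other, and $[\alpha\rangle$ denotes the right equivalence class of an epimorphism $\alpha$. Put $$\eta_{C,Y}([\alpha\rangle)=\mathrm{Im}\,\mathrm{Hom}_{\mathcal A}(C,\alpha)/\mathcal P(C,Y),$$ a $\Gamma(C)^{\mathrm{op}}$-submodule of $\underline{\mathrm{Hom}}_{\mathcal A}(C,Y)=\mathrm{Hom}_{\mathcal A}(C,Y)/\mathcal P(C,Y)$. For a short exact sequence $\xi\colon 0\to K'\to X\to Y\to 0$ let $$c(\xi,K)\colon\mathrm{Hom}_{\mathcal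 A}(K',K)\to\mathrm{Ext}^1_{\mathcal A}(Y,K)$$ be the connecting map of $\Gamma(K)$-modules, sending $u$ to the class of the pushout of $\xi$ along $u$. The sequence $\xi$ is a *universal extension of $Y$ by $K$* if $\mathrm{Ext}^1_{\mathcal A}(Y,K)$ is a finitely generated $\Gamma(K)$-module, $K'\in\mathrm{add}\,K$, and $c(\xi,K)$ is surjective and right minimal. **Proposition.** Let $\alpha\colon X\to Y$ be a right minimal epimorphism in $\mathcal A$. Then the following statements are equivalent: 1. $\alpha$ is right $C$-determined and $\eta_{C,Y}([\alpha\rangle)=0$; 2. $\mathrm{Ker}\,\alpha\in\mathrm{add}\,K$ and $\mathrm{Im}\,\mathrm{Hom}_{\mathcal A}(C,\alpha)=\mathcal P(C,Y)$; 3. the sequence $0\to\mathrm{Ker}\,\alpha\to X\xrightarrow{\alpha}Y\to 0$ is a universal extension of $Y$ by $K$. -/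

import Mathlib

open CategoryTheory CategoryTheory.Limits CategoryTheory.Abelian

universe u w v₁ u₁

noncomputable section

namespace AuslanderBijection

/-! ### Injective cogenerators -/

section Cogenerator

/-- `E` is an injective cogenerator of the category of `k`-modules: it is injective, and every
nonzero element of a module is detected by a homomorphism to `E`. -/
def IsInjectiveCogenerator (k : Type u) [CommRing k] (E : Type u) [AddCommGroup E] [Module k E] :
    Prop :=
  Module.Injective k E ∧
    ∀ (M : Type u) [AddCommGroup M] [Module k M] (m : M), m ≠ 0 → ∃ f : M →ₗ[k] E, f m ≠ 0

/-- `E` is a minimal injective cogenerator of `k`: no proper submodule of `E` is an injective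
cogenerator. -/
def IsMinimalInjectiveCogenerator (k : Type u) [CommRing k] (E : Type u) [AddCommGroup E]
    [Module k E] : Prop :=
  IsInjectiveCogenerator k E ∧ ∀ N : Submodule k E, IsInjectiveCogenerator k N → N = ⊤

end Cogenerator

/-! ### Ideals of a preadditive category and factor categories -/

/-- A two-sided ideal of morphisms of a preadditive category. -/
structure HomIdeal (A : Type u₁) [Category.{v₁} A] [Preadditive A] where
  /-- The subgroup of morphisms from `X` to `Y` that lie in the ideal. -/
  mor : ∀ X Y : A, AddSubgroup (X ⟶ Y)
  precomp_mem : ∀ {W X Y : A} (g : W ⟶ X) {f : X ⟶ Y}, f ∈ mor X Y → g ≫ f ∈ mor W Y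
  postcomp_mem : ∀ {X Y Z : A} {f : X ⟶ Y} (g : Y ⟶ Z), f ∈ mor X Y → f ≫ g ∈ mor X Z

namespace HomIdeal

variable {A : Type u₁} [Category.{v₁} A] [Preadditive A] (I : HomIdeal A)

/-- Two parallel morphisms are identified if their difference lies in the ideal. -/
def rel : HomRel A := fun X Y f g => f - g ∈ I.mor X Y

instance : Congruence I.rel where
  equivalence := fun {X Y} =>
    { refl := fun f => by simp [rel, (I.mor X Y).zero_mem]
      symm := fun {f g} h => by
        have := (I.mor X Y).neg_mem h
        rwa [neg_sub] at this
      trans := fun {f g e} h₁ h₂ => by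
        have := (I.mor X Y).add_mem h₁ h₂
        rwa [sub_add_sub_cancel] at this }
  comp_left := fun g f f' h => by
    have := I.precomp_mem g h
    rwa [Preadditive.comp_sub] at this
  comp_right := fun {X Y Z} f f' g h => by
    have := I.postcomp_mem g h
    rwa [Preadditive.sub_comp] at this

/-- The factor category of `A` modulo the ideal `I`: same objects, and morphisms modulo `I`. -/
abbrev Factor : Type u₁ := CategoryTheory.Quotient I.rel

/-- The projection to the factor category. -/
abbrev proj : A ⥤ I.Factor := CategoryTheory.Quotient.functor I.rel

theorem rel_add ⦃X Y : A⦄ (f₁ f₂ g₁ g₂ : X ⟶ Y) (hf : I.rel f₁ f₂) (hg : I.rel g₁ g₂) :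
    I.rel (f₁ + g₁) (f₂ + g₂) := by
  have := (I.mor X Y).add_mem hf hg
  rwa [sub_add_sub_comm] at this

instance : Preadditive I.Factor := CategoryTheory.Quotient.preadditive I.rel I.rel_add

instance : I.proj.Additive := CategoryTheory.Quotient.functor_additive I.rel I.rel_add

theorem rel_smul {k : Type u} [CommRing k] [Linear k A] (a : k) ⦃X Y : A⦄ (f g : X ⟶ Y)
    (h : I.rel f g) : I.rel (a • f) (a • g) := by
  have := I.precomp_mem (a • 𝟙 X) h
  simpa [rel, smul_sub] using this

instance {k : Type u} [CommRing k] [Linear k A] : Linear k I.Factor :=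
  CategoryTheory.Quotient.linear k I.rel (fun a => I.rel_smul a)

end HomIdeal

section Abelian

variable {A : Type u₁} [Category.{v₁} A] [Abelian A]

/-! ### Projectively and injectively trivial morphisms -/

/-- A morphism is projectively trivial if it factors through every epimorphism ending at its
target. -/
def ProjectivelyTrivial {X Y : A} (f : X ⟶ Y) : Prop :=
  ∀ ⦃Z : A⦄ (p : Z ⟶ Y) [Epi p], ∃ s : X ⟶ Z, s ≫ p = f

/-- A morphism is injectively trivial if it factors through every monomorphism starting at its
source. -/
def InjectivelyTrivial {X Y : A} (f : X ⟶ Y) : Prop :=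
  ∀ ⦃Z : A⦄ (i : X ⟶ Z) [Mono i], ∃ s : Z ⟶ Y, i ≫ s = f

variable (A) in
/-- The ideal of projectively trivial morphisms. -/
def projIdeal : HomIdeal A where
  mor X Y :=
    { carrier := {f | ProjectivelyTrivial f}
      zero_mem' := fun Z p _ => ⟨0, by simp⟩
      add_mem' := fun {f g} hf hg Z p _ => by
        obtain ⟨s, hs⟩ := hf p
        obtain ⟨t, ht⟩ := hg p
        exact ⟨s + t, by simp [hs, ht]⟩
      neg_mem' := fun {f} hf Z p _ => by
        obtain ⟨s, hs⟩ := hf p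
        exact ⟨-s, by simp [hs]⟩ }
  precomp_mem g f hf Z p _ := by
    obtain ⟨s, hs⟩ := hf p
    exact ⟨g ≫ s, by simp [hs]⟩
  postcomp_mem g hf Z p _ := by
    obtain ⟨s, hs⟩ := hf (pullback.fst g p)
    exact ⟨s ≫ pullback.snd g p, by
      rw [Category.assoc, ← pullback.condition, ← Category.assoc, hs]⟩

variable (A) in
/-- The ideal of injectively trivial morphisms. -/
def injIdeal : HomIdeal A where
  mor X Y :=
    { carrier := {f | InjectivelyTrivial f}
      zero_mem' := fun Z p _ => ⟨0, by simp⟩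
      add_mem' := fun {f g} hf hg Z p _ => by
        obtain ⟨s, hs⟩ := hf p
        obtain ⟨t, ht⟩ := hg p
        exact ⟨s + t, by simp [hs, ht]⟩
      neg_mem' := fun {f} hf Z p _ => by
        obtain ⟨s, hs⟩ := hf p
        exact ⟨-s, by simp [hs]⟩ }
  precomp_mem g f hf Z p _ := by
    obtain ⟨s, hs⟩ := hf (pushout.inl g p)
    exact ⟨pushout.inr g p ≫ s, by
      rw [← Category.assoc, ← pushout.condition, Category.assoc, hs]⟩
  postcomp_mem g hf Z p _ := by
    obtain ⟨s, hs⟩ := hf p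
    exact ⟨s ≫ g, by rw [← Category.assoc, hs]⟩

/-- `𝒫(C, Y)` as a submodule of the right `End C`-module `Hom(C, Y)`. -/
def projTrivialSubmodule (C Y : A) : Submodule (End C)ᵐᵒᵖ (C ⟶ Y) where
  toAddSubmonoid := ((projIdeal A).mor C Y).toAddSubmonoid
  smul_mem' c _ hf := (projIdeal A).precomp_mem (c.unop : C ⟶ C) hf

/-! ### Auslander-Reiten duality -/

/-- Auslander-Reiten duality for a `k`-linear abelian category, where `D = Hom_k(-, E)`:
a `k`-linear equivalence `τ` from the category modulo projectively trivial morphisms to the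
category modulo injectively trivial morphisms, with `k`-linear isomorphisms from `D Ext¹(X, Y)`
to the morphisms from `Y` to `τ X` modulo injectively trivial ones, natural in `X` and `Y`. -/
structure ARDuality (k : Type u) [CommRing k] (E : Type u) [AddCommGroup E] [Module k E]
    (A : Type u₁) [Category.{v₁} A] [Abelian A] [Linear k A] [HasExt.{w} A] where
  /-- The Auslander-Reiten translation. -/
  τ : (projIdeal A).Factor ≌ (injIdeal A).Factor
  additive : τ.functor.Additive
  linear : τ.functor.Linear k
  /-- The duality isomorphism. -/
  Φ : ∀ X Y : A, (Ext X Y 1 →ₗ[k] E) ≃ₗ[k]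
    ((injIdeal A).proj.obj Y ⟶ τ.functor.obj ((projIdeal A).proj.obj X))
  naturality : ∀ {X X' Y Y' : A} (f : X ⟶ X') (g : Y' ⟶ Y) (φ : Ext X Y 1 →ₗ[k] E),
    Φ X' Y' (φ ∘ₗ (Ext.mk₀ f).precompOfLinear k Y (zero_add 1) ∘ₗ
        (Ext.mk₀ g).postcompOfLinear k X' (add_zero 1)) =
      (injIdeal A).proj.map g ≫ Φ X Y φ ≫ τ.functor.map ((projIdeal A).proj.map f)

/-! ### Right minimal, right determined and right equivalent morphisms -/

/-- Every endomorphism `s` of the source with `α ∘ s = α` is an automorphism. -/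
def RightMinimal {X Y : A} (α : X ⟶ Y) : Prop :=
  ∀ s : X ⟶ X, s ≫ α = α → IsIso s

/-- `α` is right `C`-determined: a morphism `t : T ⟶ Y` factors through `α` as soon as `t ∘ φ`
factors through `α` for all `φ : C ⟶ T`. -/
def RightDetermined (C : A) {X Y : A} (α : X ⟶ Y) : Prop :=
  ∀ ⦃T : A⦄ (t : T ⟶ Y), (∀ φ : C ⟶ T, ∃ s : C ⟶ X, s ≫ α = φ ≫ t) → ∃ s : T ⟶ X, s ≫ α = t

/-- An epimorphism to `Y`. -/
structure EpiTo (Y : A) where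
  /-- The source. -/
  src : A
  /-- The morphism. -/
  hom : src ⟶ Y
  epi : Epi hom

/-- Right equivalence: each of the two epimorphisms factors through the other. -/
instance rightEquivalence (Y : A) : Setoid (EpiTo Y) where
  r α β := (∃ s : α.src ⟶ β.src, s ≫ β.hom = α.hom) ∧ ∃ s : β.src ⟶ α.src, s ≫ α.hom = β.hom
  iseqv :=
    { refl := fun α => ⟨⟨𝟙 _, Category.id_comp _⟩, ⟨𝟙 _, Category.id_comp _⟩⟩
      symm := fun h => ⟨h.2, h.1⟩
      trans := by
        rintro α β γ ⟨⟨s, hs⟩, ⟨s', hs'⟩⟩ ⟨⟨t, ht⟩, ⟨t', ht'⟩⟩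
        exact ⟨⟨s ≫ t, by rw [Category.assoc, ht, hs]⟩,
          ⟨t' ≫ s', by rw [Category.assoc, hs', ht']⟩⟩ }

/-- The right equivalence classes of epimorphisms to `Y`. -/
abbrev EpiClass (Y : A) := _root_.Quotient (rightEquivalence Y)

/-- The right equivalence class of an epimorphism. -/
def epiClass {X Y : A} (α : X ⟶ Y) [Epi α] : EpiClass Y := ⟦⟨X, α, inferInstance⟩⟧

/-! ### The map `η` -/

/-- The map `Hom(C, α) : Hom(C, X) → Hom(C, Y)` of right `End C`-modules. -/
def homMap (C : A) {X Y : A} (α : X ⟶ Y) : (C ⟶ X) →ₗ[(End C)ᵐᵒᵖ] (C ⟶ Y) where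
  toFun f := f ≫ α
  map_add' _ _ := Preadditive.add_comp _ _ _ _ _ _
  map_smul' _ _ := Category.assoc _ _ _

/-- The map `η` from right equivalence classes of epimorphisms to `Y` to the `(End C)ᵒᵖ`-submodules
of `Hom(C, Y) / 𝒫(C, Y)`, sending the class of `α` to `Im Hom(C, α) / 𝒫(C, Y)`. -/
def eta (C Y : A) :
    EpiClass Y → Submodule (End C)ᵐᵒᵖ ((C ⟶ Y) ⧸ projTrivialSubmodule C Y) :=
  _root_.Quotient.lift
    (fun α => (LinearMap.range (homMap C α.hom)).map (projTrivialSubmodule C Y).mkQ) (by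
      rintro α β ⟨⟨s, hs⟩, ⟨t, ht⟩⟩
      have : LinearMap.range (homMap C α.hom) = LinearMap.range (homMap C β.hom) := by
        apply le_antisymm
        · rintro _ ⟨f, rfl⟩
          exact ⟨f ≫ s, by simp [homMap, hs]⟩
        · rintro _ ⟨f, rfl⟩
          exact ⟨f ≫ t, by simp [homMap, ht]⟩
      simp only [this])

/-! ### Universal extensions -/

attribute [local instance] Abelian.hasFiniteBiproducts

/-- `K'` lies in `add K`: it is a direct summand of a finite direct sum of copies of `K`. -/
def InAdd (K K' : A) : Prop :=
  ∃ n : ℕ, Nonempty (Retract K' (⨁ fun _ : Fin n => K))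

section Ext

variable [HasExt.{w} A]

/-- The left `End K`-module structure on `Ext` groups with second argument `K`, by pushing out. -/
instance extModule (Y K : A) (n : ℕ) : Module (End K) (Ext Y K n) where
  smul c x := x.comp (Ext.mk₀ (c : K ⟶ K)) (add_zero n)
  one_smul x := Ext.comp_mk₀_id x
  mul_smul c d x := by
    change x.comp (Ext.mk₀ ((d : K ⟶ K) ≫ (c : K ⟶ K))) _ =
      (x.comp (Ext.mk₀ (d : K ⟶ K)) _).comp (Ext.mk₀ (c : K ⟶ K)) _
    rw [Ext.comp_assoc_of_third_deg_zero, Ext.mk₀_comp_mk₀]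
  smul_zero c := Ext.zero_comp _ _ _ _ _
  smul_add c x y := Ext.add_comp _ _ _ _
  add_smul c d x := by
    change x.comp (Ext.mk₀ ((c : K ⟶ K) + (d : K ⟶ K))) _ = _
    rw [Ext.mk₀_add, Ext.comp_add]
    rfl
  zero_smul x := by
    change x.comp (Ext.mk₀ (0 : K ⟶ K)) _ = _
    rw [Ext.mk₀_zero, Ext.comp_zero]

/-- The connecting map `Hom(K', Z) → Ext¹(Y, Z)` of left `End Z`-modules attached to a short exact
sequence `ξ : 0 ⟶ K' ⟶ X ⟶ Y ⟶ 0`. It sends `s` to the class of the pushout of `ξ` along `s`, that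
is, to the product of the class of `ξ` with `s`. -/
def connectingMap {S : ShortComplex A} (hS : S.ShortExact) (Z : A) :
    (S.X₁ ⟶ Z) →ₗ[End Z] Ext S.X₃ Z 1 where
  toFun s := hS.extClass.comp (Ext.mk₀ s) (add_zero 1)
  map_add' s t := by rw [Ext.mk₀_add, Ext.comp_add]
  map_smul' c s := by
    change hS.extClass.comp (Ext.mk₀ (s ≫ (c : Z ⟶ Z))) _ =
      (hS.extClass.comp (Ext.mk₀ s) _).comp (Ext.mk₀ (c : Z ⟶ Z)) _
    rw [Ext.comp_assoc_of_third_deg_zero, Ext.mk₀_comp_mk₀]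

end Ext

end Abelian

/-- A homomorphism of modules is right minimal if every endomorphism `h` of its source with
`c ∘ h = c` is an automorphism. -/
def LinearRightMinimal {R M N : Type*} [Ring R] [AddCommGroup M] [Module R M] [AddCommGroup N]
    [Module R N] (c : M →ₗ[R] N) : Prop :=
  ∀ h : M →ₗ[R] M, c ∘ₗ h = c → Function.Bijective h

section Universal

variable {A : Type u₁} [Category.{v₁} A] [Abelian A]

/-- The sequence `0 ⟶ Ker α ⟶ X ⟶ Y ⟶ 0`. -/
abbrev kernelSequence {X Y : A} (α : X ⟶ Y) : ShortComplex A :=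
  ShortComplex.mk (kernel.ι α) α (kernel.condition α)

theorem kernelSequence_shortExact {X Y : A} (α : X ⟶ Y) [Epi α] :
    (kernelSequence α).ShortExact where
  exact := ShortComplex.exact_of_f_is_kernel _ (kernelIsKernel α)

variable [HasExt.{w} A]

/-- The short exact sequence `0 ⟶ K' ⟶ X ⟶ Y ⟶ 0` is a universal `L`-extension of `Y` by `K`, for
a finitely generated `End K`-submodule `L` of `Ext¹(Y, K)`. -/
structure IsUniversalLExtension (K : A) {S : ShortComplex A} (hS : S.ShortExact)
    (L : Submodule (End K) (Ext S.X₃ K 1)) : Prop where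
  fg : L.FG
  inAdd : InAdd K S.X₁
  range_eq : LinearMap.range (connectingMap hS K) = L
  rightMinimal : LinearRightMinimal (connectingMap hS K)

/-- The short exact sequence `0 ⟶ K' ⟶ X ⟶ Y ⟶ 0` is a universal extension of `Y` by `K`:
`Ext¹(Y, K)` is finitely generated over `End K`, and the sequence is a universal
`Ext¹(Y, K)`-extension. -/
def IsUniversalExtension (K : A) {S : ShortComplex A} (hS : S.ShortExact) : Prop :=
  IsUniversalLExtension K hS ⊤

end Universal

end AuslanderBijection

end

open AuslanderBijection

/-! Auslander–Reiten duality is condensed into one linear form `γ` on Ext¹(C, K): the form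
corresponding to an isomorphism K ≅ τC modulo injectively trivial morphisms. The pairing (g, y) ↦
γ(gy) of Hom(C, Z) with Ext¹(Z, K) represents every form on Ext¹(Z, K), and its radical in Hom(C, Z)
is 𝒫(C, Z); forms on Ext¹(C, Z) likewise come from Hom(Z, K) (`IsPerfect`). Lifting t : T ⟶ Y along
α is obstructed by a class in Ext¹(T, Ker α), and `γ` allows such classes to be tested on morphisms
from C and to K. Hence, for right minimal α, being right C-determined amounts to Ker α ∈ add K
(`rightDetermined`, `inAdd_kernel`). For Z = Y, Im Hom(C, α) is the annihilator of the image of the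
connecting map, so it equals 𝒫(C, Y) exactly when that map is surjective
(`surjective_connectingMap_iff`). Finite generation and right minimality in 3 follow from
Hom-finiteness and from right minimality of α. -/

namespace AuslanderBijection

/-! ### Duals with respect to an injective cogenerator. -/

section Cogenerator

variable {k : Type u} [CommRing k] {E : Type u} [AddCommGroup E] [Module k E]

/-- The definition only tests modules in the universe of `k`. The cyclic submodule generated by `m`
is a quotient of `k`, hence has a copy there, and injectivity extends the form to `M`. -/
theorem IsInjectiveCogenerator.exists_apply_ne_zero (hE : IsInjectiveCogenerator k E)
    {M : Type*} [AddCommGroup M] [Module k M] {m : M} (hm : m ≠ 0) :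
    ∃ f : M →ₗ[k] E, f m ≠ 0 := by
  have := hE.1
  let e := LinearMap.quotKerEquivRange (LinearMap.toSpanSingleton k M m)
  let i : (k ⧸ LinearMap.ker (LinearMap.toSpanSingleton k M m)) →ₗ[k] M :=
    (LinearMap.range (LinearMap.toSpanSingleton k M m)).subtype ∘ₗ e.toLinearMap
  have hi : Function.Injective i := Subtype.val_injective.comp e.injective
  have h1 : i (Submodule.Quotient.mk 1) = m := by
    change ((e (Submodule.Quotient.mk 1) : _) : M) = m
    erw [LinearMap.quotKerEquivRange_apply_mk]
    simp
  obtain ⟨f, hf⟩ := hE.2 _ (Submodule.Quotient.mk 1 :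
    k ⧸ LinearMap.ker (LinearMap.toSpanSingleton k M m)) (by
      intro h
      rw [h, map_zero] at h1
      exact hm h1.symm)
  obtain ⟨g, hg⟩ := Module.Injective.extension_property k E _ _ i hi f
  refine ⟨g, ?_⟩
  rwa [← h1, ← LinearMap.comp_apply, hg]

theorem IsInjectiveCogenerator.exists_separating (hE : IsInjectiveCogenerator k E)
    {M : Type*} [AddCommGroup M] [Module k M] (N : Submodule k M) {m : M} (hm : m ∉ N) :
    ∃ f : M →ₗ[k] E, (∀ x ∈ N, f x = 0) ∧ f m ≠ 0 := by
  obtain ⟨f, hf⟩ := hE.exists_apply_ne_zero (m := N.mkQ m) (by simpa using hm)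
  exact ⟨f ∘ₗ N.mkQ, fun x hx => by simp [(Submodule.Quotient.mk_eq_zero N).2 hx], hf⟩

/-- A module is noetherian if its dual with respect to an injective cogenerator is artinian. -/
theorem IsInjectiveCogenerator.isNoetherian_of_dual (hE : IsInjectiveCogenerator k E)
    {M : Type*} [AddCommGroup M] [Module k M] [IsArtinian k (M →ₗ[k] E)] : IsNoetherian k M := by
  let perp : Submodule k M → Submodule k (M →ₗ[k] E) := fun N =>
    { carrier := {f | ∀ x ∈ N, f x = 0}
      zero_mem' := fun _ _ => rfl
      add_mem' := fun {f g} hf hg x hx => by simp [hf x hx, hg x hx]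
      smul_mem' := fun a f hf x hx => by simp [hf x hx] }
  have hperp : StrictAnti perp := by
    intro N N' h
    refine lt_of_le_of_ne (fun f hf x hx => hf x (h.le hx)) fun heq => ?_
    obtain ⟨x, hx, hx'⟩ := SetLike.exists_of_lt h
    obtain ⟨f, hf, hfx⟩ := hE.exists_separating N hx'
    have : f ∈ perp N' := heq ▸ hf
    exact hfx (this x hx)
  rw [isNoetherian_iff']
  exact hperp.wellFoundedGT

end Cogenerator

/-! ### The kernel sequence, its pushouts and its extension class. -/

section Kernel

variable {A : Type u₁} [Category.{v₁} A] [Abelian A]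

theorem exists_kernel_restriction {X Y : A} {α : X ⟶ Y} (s : X ⟶ X) (hs : s ≫ α = α) :
    ∃ r : kernel α ⟶ kernel α, r ≫ kernel.ι α = kernel.ι α ≫ s :=
  ⟨kernel.lift α (kernel.ι α ≫ s) (by simp [hs]), by simp⟩

/-- The sequence `0 ⟶ Z ⟶ X' ⟶ Y ⟶ 0` obtained from `0 ⟶ Ker α ⟶ X ⟶ Y ⟶ 0` by pushing out along
a morphism `Ker α ⟶ Z`. -/
noncomputable abbrev pushoutSequence {X Y Z : A} (α : X ⟶ Y) (v : kernel α ⟶ Z) : ShortComplex A :=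
  ShortComplex.mk (pushout.inr (kernel.ι α) v) (pushout.desc α 0 (by simp))
    (pushout.inr_desc _ _ _)

theorem pushoutSequence_shortExact {X Y Z : A} (α : X ⟶ Y) [Epi α] (v : kernel α ⟶ Z) :
    (pushoutSequence α v).ShortExact := by
  have hepi : Epi (pushoutSequence α v).g :=
    epi_of_epi_fac (f := pushout.inl (kernel.ι α) v) (h := α)
      (pushout.inl_desc _ _ _)
  refine { exact := ?_, mono_f := inferInstance, epi_g := hepi }
  apply ShortComplex.exact_of_g_is_cokernel
  have key {W : A} (m : pushout (kernel.ι α) v ⟶ W) (hm : pushout.inr (kernel.ι α) v ≫ m = 0) :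
      kernel.ι α ≫ pushout.inl (kernel.ι α) v ≫ m = 0 := by
    rw [pushout.condition_assoc, hm, comp_zero]
  refine CokernelCofork.IsColimit.ofπ _ _
    (fun m hm => (Abelian.epiDesc α (pushout.inl _ _ ≫ m) (key m hm))) (fun m hm => ?_)
    (fun m hm b hb => ?_)
  · apply pushout.hom_ext
    · rw [pushout.inl_desc_assoc, Abelian.comp_epiDesc]
    · rw [pushout.inr_desc_assoc, zero_comp]
      exact hm.symm
  · rw [← cancel_epi α, Abelian.comp_epiDesc, ← hb]
    exact (pushout.inl_desc_assoc _ _ _ _).symm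

/-- The morphism from `0 ⟶ Ker α ⟶ X ⟶ Y ⟶ 0` to its pushout. -/
noncomputable def toPushoutSequence {X Y Z : A} (α : X ⟶ Y) (v : kernel α ⟶ Z) :
    kernelSequence α ⟶ pushoutSequence α v where
  τ₁ := v
  τ₂ := pushout.inl _ _
  τ₃ := 𝟙 _
  comm₁₂ := pushout.condition.symm
  comm₂₃ := (pushout.inl_desc _ _ _).trans (Category.comp_id _).symm

attribute [local instance] Abelian.hasFiniteBiproducts

/-- A linear endomorphism of `Hom(K', K)` is induced by an endomorphism of `K'`, if `K'` lies in
`add K`. -/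
theorem InAdd.exists_hom_of_linearMap {K K' : A} (h : InAdd K K')
    (c : (K' ⟶ K) →ₗ[End K] (K' ⟶ K)) : ∃ s : K' ⟶ K', ∀ f, c f = s ≫ f := by
  obtain ⟨n, ⟨r⟩⟩ := h
  -- The components `r.i ≫ π i` generate Hom(K', K) over `End K`, so `c` is determined by its values
  -- on them; `s` reassembles these values.
  refine ⟨∑ i : Fin n, c (r.i ≫ biproduct.π (fun _ : Fin n => K) i) ≫
      biproduct.ι (fun _ : Fin n => K) i ≫ r.r, fun f => ?_⟩
  have hf : f = ∑ i : Fin n, (show End K from biproduct.ι (fun _ : Fin n => K) i ≫ r.r ≫ f) •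
      (r.i ≫ biproduct.π (fun _ : Fin n => K) i) := by
    change f = ∑ i : Fin n, (r.i ≫ biproduct.π (fun _ : Fin n => K) i) ≫
      biproduct.ι (fun _ : Fin n => K) i ≫ r.r ≫ f
    have := r.i ≫= biproduct.total (f := fun _ : Fin n => K) =≫ (r.r ≫ f)
    rw [Category.id_comp, r.retract_assoc] at this
    simpa only [Preadditive.comp_sum, Preadditive.sum_comp, Category.assoc] using this.symm
  conv_lhs => rw [hf, map_sum]
  simp only [map_smul, Preadditive.sum_comp, Category.assoc]
  rfl

variable [HasExt.{w} A]

/-- The class of `0 ⟶ Ker α ⟶ X ⟶ Y ⟶ 0`. -/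
noncomputable abbrev kernelClass {X Y : A} (α : X ⟶ Y) [Epi α] : Ext.{w} Y (kernel α) 1 :=
  (kernelSequence_shortExact α).extClass

/-- Exactness of Hom(T, X) → Hom(T, Y) → Ext¹(T, Ker α). -/
theorem factors_iff_comp_kernelClass_eq_zero {X Y T : A} (α : X ⟶ Y) [Epi α] (t : T ⟶ Y) :
    (∃ s : T ⟶ X, s ≫ α = t) ↔
      (Ext.mk₀ t).comp (kernelClass.{w} α) (zero_add 1) = 0 := by
  constructor
  · rintro ⟨s, rfl⟩
    rw [← Ext.mk₀_comp_mk₀_assoc]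
    erw [(kernelSequence_shortExact α).comp_extClass]
    rw [Ext.comp_zero]
  · intro h
    obtain ⟨x, hx⟩ := Ext.covariant_sequence_exact₃ T (kernelSequence_shortExact α)
      (Ext.mk₀ t) (zero_add 1) h
    obtain ⟨s, rfl⟩ := (Ext.mk₀_bijective _ _).2 x
    exact ⟨s, (Ext.mk₀_bijective _ _).1 ((Ext.mk₀_comp_mk₀ _ _).symm.trans hx)⟩

/-- An endomorphism of `Ker α` fixing the class of the kernel sequence is an automorphism,
if `α` is right minimal. -/
theorem isIso_of_kernelClass_comp_eq {X Y : A} (α : X ⟶ Y) [Epi α] (hα : RightMinimal α)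
    (s : kernel α ⟶ kernel α)
    (hs : (kernelClass.{w} α).comp (Ext.mk₀ s) (add_zero 1) = kernelClass α) : IsIso s := by
  -- Since `s - 𝟙` kills the class, it extends along `kernel.ι α` to some `d : X ⟶ kernel α`. Then
  -- `𝟙 X + d ≫ kernel.ι α` is an endomorphism over `Y` restricting to `s`.
  obtain ⟨x, hx⟩ := Ext.contravariant_sequence_exact₁ (kernelSequence_shortExact α) (kernel α)
    (Ext.mk₀ (s - 𝟙 _)) (add_zero 1) (by
      rw [sub_eq_add_neg, Ext.mk₀_add, Ext.mk₀_neg, Ext.comp_add, Ext.comp_neg,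
        Ext.comp_mk₀_id, ← sub_eq_add_neg, sub_eq_zero]
      exact hs)
  obtain ⟨d, rfl⟩ := (Ext.mk₀_bijective _ _).2 x
  have hd : kernel.ι α ≫ d = s - 𝟙 _ :=
    (Ext.mk₀_bijective _ _).1 ((Ext.mk₀_comp_mk₀ _ _).symm.trans hx)
  have hσ : (𝟙 X + d ≫ kernel.ι α) ≫ α = α := by simp
  have hσι : kernel.ι α ≫ (𝟙 X + d ≫ kernel.ι α) = s ≫ kernel.ι α := by
    rw [Preadditive.comp_add, reassoc_of% hd]
    simp
  have := hα _ hσ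
  obtain ⟨r, hr⟩ := exists_kernel_restriction (inv (𝟙 X + d ≫ kernel.ι α))
    (α := α) (by rw [IsIso.inv_comp_eq, hσ])
  refine ⟨r, ?_, ?_⟩
  · rw [← cancel_mono (kernel.ι α), Category.assoc, hr, ← reassoc_of% hσι]
    simp
  · rw [← cancel_mono (kernel.ι α), Category.assoc, ← hσι, reassoc_of% hr, IsIso.inv_hom_id]
    simp

/-- The identity of `K'` is a finite sum of morphisms factoring through `K`. -/
theorem InAdd.ext_eq_zero {K K' T : A} (h : InAdd K K') (x : Ext.{w} T K' 1)
    (hx : ∀ f : K' ⟶ K, x.comp (Ext.mk₀ f) (add_zero 1) = 0) : x = 0 := by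
  obtain ⟨n, ⟨r⟩⟩ := h
  have hid : 𝟙 K' = ∑ i : Fin n, (r.i ≫ biproduct.π (fun _ : Fin n => K) i) ≫
      biproduct.ι (fun _ : Fin n => K) i ≫ r.r := by
    have := r.i ≫= biproduct.total (f := fun _ : Fin n => K) =≫ r.r
    rw [Category.id_comp, r.retract] at this
    simpa only [Preadditive.comp_sum, Preadditive.sum_comp, Category.assoc] using this.symm
  rw [← Ext.comp_mk₀_id x, hid, ← Ext.addEquiv₀_symm_apply, map_sum, ← Ext.bilinearComp_apply_apply, map_sum]
  refine Finset.sum_eq_zero fun i _ => ?_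
  rw [Ext.addEquiv₀_symm_apply, Ext.bilinearComp_apply_apply, ← Ext.mk₀_comp_mk₀,
    ← Ext.comp_assoc_of_third_deg_zero, hx, Ext.zero_comp]

end Kernel

/-! ### The perfect form and its consequences. -/

section Duality

variable {k : Type u} [CommRing k] {E : Type u} [AddCommGroup E] [Module k E]
    {A : Type u₁} [Category.{v₁} A] [Abelian A] [Linear k A] [HasExt.{w} A]

/-- A linear form `γ` on `Ext¹(C, K)` is perfect if products with `γ` represent all linear forms on
`Ext¹(C, Z)` by morphisms `Z ⟶ K` and all linear forms on `Ext¹(Z, K)` by morphisms `C ⟶ Z`, the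
latter uniquely up to projectively trivial morphisms. -/
structure IsPerfect {C K : A} (γ : Ext.{w} C K 1 →ₗ[k] E) : Prop where
  exists_right : ∀ (Z : A) (φ : Ext.{w} C Z 1 →ₗ[k] E), ∃ f : Z ⟶ K,
    ∀ x, γ (x.comp (Ext.mk₀ f) (add_zero 1)) = φ x
  exists_left : ∀ (Z : A) (φ : Ext.{w} Z K 1 →ₗ[k] E), ∃ g : C ⟶ Z,
    ∀ y, γ ((Ext.mk₀ g).comp y (zero_add 1)) = φ y
  left_iff : ∀ (Z : A) (g : C ⟶ Z),
    (∀ y, γ ((Ext.mk₀ g).comp y (zero_add 1)) = 0) ↔ ProjectivelyTrivial g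

/-- Naturality of `Φ` turns products with `γ` into composition with the isomorphism `θ`; everything
then follows from `θ` being invertible and `τ` an equivalence. -/
theorem ARDuality.exists_isPerfect (D : ARDuality k E A) {K C : A}
    (hC : Nonempty
      ((projIdeal A).proj.obj C ≅ D.τ.inverse.obj ((injIdeal A).proj.obj K))) :
    ∃ γ : Ext.{w} C K 1 →ₗ[k] E, IsPerfect γ := by
  obtain ⟨e⟩ := hC
  let θ : (injIdeal A).proj.obj K ≅ D.τ.functor.obj ((projIdeal A).proj.obj C) :=
    (D.τ.counitIso.app _).symm ≪≫ D.τ.functor.mapIso e.symm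
  have hadd := D.additive
  let γ := (D.Φ C K).symm θ.hom
  have hγ : D.Φ C K γ = θ.hom := LinearEquiv.apply_symm_apply _ _
  have hleft (Z : A) (g : C ⟶ Z) :
      D.Φ Z K (γ ∘ₗ (Ext.mk₀ g).precompOfLinear k K (zero_add 1)) =
        θ.hom ≫ D.τ.functor.map ((projIdeal A).proj.map g) := by
    have := D.naturality g (𝟙 K) γ
    rw [hγ, CategoryTheory.Functor.map_id, Category.id_comp] at this
    rw [← this]
    congr 1
    ext y
    simp
  refine ⟨γ, ⟨fun Z φ => ?_, fun Z φ => ?_, fun Z g => ?_⟩⟩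
  · obtain ⟨f, hf⟩ := (injIdeal A).proj.map_surjective (D.Φ C Z φ ≫ θ.inv)
    have := D.naturality (𝟙 C) f γ
    rw [hγ, hf, CategoryTheory.Functor.map_id, CategoryTheory.Functor.map_id, Category.comp_id, Category.assoc, θ.inv_hom_id,
      Category.comp_id] at this
    refine ⟨f, fun x => ?_⟩
    rw [← (D.Φ C Z).injective this]
    simp
  · obtain ⟨g', hg'⟩ := D.τ.functor.map_surjective (θ.inv ≫ D.Φ Z K φ)
    obtain ⟨g, rfl⟩ := (projIdeal A).proj.map_surjective g'
    have := hleft Z g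
    rw [hg', θ.hom_inv_id_assoc] at this
    refine ⟨g, fun y => ?_⟩
    rw [← (D.Φ Z K).injective this]
    simp
  · have h1 : (∀ y, γ ((Ext.mk₀ g).comp y (zero_add 1)) = 0) ↔
        γ ∘ₗ (Ext.mk₀ g).precompOfLinear k K (zero_add 1) = 0 := by
      rw [LinearMap.ext_iff]
      simp
    have h2 : (projIdeal A).proj.map g = 0 ↔ ProjectivelyTrivial g := by
      rw [← Functor.map_zero, CategoryTheory.Quotient.functor_map_eq_iff]
      change g - 0 ∈ (projIdeal A).mor C Z ↔ _
      rw [sub_zero]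
      rfl
    rw [h1, ← h2, ← (D.Φ Z K).map_eq_zero_iff, hleft, ← D.τ.functor.map_eq_zero_iff]
    exact ⟨fun h => by rw [← cancel_epi θ.hom, h, comp_zero], fun h => by rw [h, comp_zero]⟩

namespace IsPerfect

variable {C K : A} {γ : Ext.{w} C K 1 →ₗ[k] E}

theorem eq_zero_of_comp_right (hγ : IsPerfect γ) (hE : IsInjectiveCogenerator k E) {Z : A}
    (x : Ext.{w} C Z 1) (hx : ∀ f : Z ⟶ K, x.comp (Ext.mk₀ f) (add_zero 1) = 0) : x = 0 := by
  by_contra h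
  obtain ⟨φ, hφ⟩ := hE.exists_apply_ne_zero h
  obtain ⟨f, hf⟩ := hγ.exists_right Z φ
  exact hφ (by rw [← hf, hx, map_zero])

theorem eq_zero_of_comp_left (hγ : IsPerfect γ) (hE : IsInjectiveCogenerator k E) {Z : A}
    (y : Ext.{w} Z K 1) (hy : ∀ g : C ⟶ Z, (Ext.mk₀ g).comp y (zero_add 1) = 0) : y = 0 := by
  by_contra h
  obtain ⟨φ, hφ⟩ := hE.exists_apply_ne_zero h
  obtain ⟨g, hg⟩ := hγ.exists_left Z φ
  exact hφ (by rw [← hg, hy, map_zero])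

/-- The dual of Ext¹(Y, K) is a quotient of Hom(C, Y), which is artinian over `k`. -/
theorem isNoetherian_ext (hγ : IsPerfect γ) (hE : IsInjectiveCogenerator k E)
    [IsArtinianRing k] (Y : A) [Module.Finite k (C ⟶ Y)] :
    IsNoetherian k (Ext.{w} Y K 1) := by
  let p : (C ⟶ Y) →ₗ[k] (Ext.{w} Y K 1 →ₗ[k] E) :=
    { toFun := fun g => γ ∘ₗ (Ext.mk₀ g).precompOfLinear k K (zero_add 1)
      map_add' := fun f g => by ext y; simp [Ext.mk₀_add]
      map_smul' := fun a g => by ext y; simp [Ext.mk₀_smul] }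
  have hp : Function.Surjective p := fun φ => by
    obtain ⟨g, hg⟩ := hγ.exists_left Y φ
    exact ⟨g, LinearMap.ext hg⟩
  have : IsArtinian k (Ext.{w} Y K 1 →ₗ[k] E) := isArtinian_of_surjective _ p hp
  exact hE.isNoetherian_of_dual

theorem fg_top_ext (hγ : IsPerfect γ) (hE : IsInjectiveCogenerator k E)
    [IsArtinianRing k] (Y : A) [Module.Finite k (C ⟶ Y)] :
    (⊤ : Submodule (End K) (Ext.{w} Y K 1)).FG := by
  have := hγ.isNoetherian_ext hE Y
  obtain ⟨s, hs⟩ := IsNoetherian.noetherian (⊤ : Submodule k (Ext.{w} Y K 1))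
  refine ⟨s, eq_top_iff.2 fun x _ => ?_⟩
  have hx : x ∈ Submodule.span k (s : Set (Ext.{w} Y K 1)) := hs ▸ Submodule.mem_top
  induction hx using Submodule.span_induction with
  | mem x h => exact Submodule.subset_span h
  | zero => exact Submodule.zero_mem _
  | add x y _ _ hx hy => exact Submodule.add_mem _ (hx trivial) (hy trivial)
  | smul a x _ hx =>
    rw [Ext.smul_eq_comp_mk₀]
    exact Submodule.smul_mem _ (show End K from a • 𝟙 K) (hx trivial)

variable {X Y : A} {α : X ⟶ Y} [Epi α]

/-- For source `C`, the obstruction is detected by morphisms to `K` even when Ker α is not in add K.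
-/
theorem factors_iff (hγ : IsPerfect γ) (hE : IsInjectiveCogenerator k E) (g : C ⟶ Y) :
    (∃ s : C ⟶ X, s ≫ α = g) ↔ ∀ f : kernel α ⟶ K,
      (Ext.mk₀ g).comp ((kernelClass.{w} α).comp (Ext.mk₀ f) (add_zero 1)) (zero_add 1) = 0 := by
  rw [factors_iff_comp_kernelClass_eq_zero.{w}]
  constructor
  · intro h f
    rw [← Ext.comp_assoc_of_third_deg_zero, h, Ext.zero_comp]
  · intro h
    exact hγ.eq_zero_of_comp_right hE _ fun f => by
      rw [Ext.comp_assoc_of_third_deg_zero, h]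

theorem rightDetermined (hγ : IsPerfect γ) (hE : IsInjectiveCogenerator k E)
    (h : InAdd K (kernel α)) : RightDetermined C α := by
  intro T t ht
  rw [factors_iff_comp_kernelClass_eq_zero.{w}]
  refine h.ext_eq_zero _ fun f => hγ.eq_zero_of_comp_left hE _ fun g => ?_
  have := (factors_iff_comp_kernelClass_eq_zero.{w} α (g ≫ t)).1 (ht g)
  rw [← Ext.mk₀_comp_mk₀_assoc] at this
  rw [← Ext.comp_assoc_of_third_deg_zero, this, Ext.zero_comp]

attribute [local instance] Abelian.hasFiniteBiproducts

theorem inAdd_kernel (hγ : IsPerfect γ) (hE : IsInjectiveCogenerator k E)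
    [Module.Finite k (kernel α ⟶ K)] (hα : RightMinimal α) (h : RightDetermined C α) :
    InAdd K (kernel α) := by
  obtain ⟨n, u, hu⟩ := Module.Finite.exists_fin (R := k) (M := kernel α ⟶ K)
  let v : kernel α ⟶ ⨁ fun _ : Fin n => K := biproduct.lift u
  have hv (f : kernel α ⟶ K) : ∃ q : (⨁ fun _ : Fin n => K) ⟶ K, v ≫ q = f := by
    have hf : f ∈ Submodule.span k (Set.range u) := hu ▸ Submodule.mem_top
    obtain ⟨a, rfl⟩ := (Submodule.mem_span_range_iff_exists_fun k).1 hf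
    refine ⟨∑ i, a i • biproduct.π _ i, ?_⟩
    simp [v, Preadditive.comp_sum]
  -- Every test morphism to `K` factors through `v`, and the pushout class vanishes when pulled back
  -- along its own epimorphism. So determinedness lifts that epimorphism along `α`.
  obtain ⟨s, hs⟩ := h (pushoutSequence α v).g (fun φ => by
    rw [hγ.factors_iff hE]
    intro f
    obtain ⟨q, rfl⟩ := hv f
    have hnat := ShortComplex.ShortExact.extClass_naturality (kernelSequence_shortExact α)
      (pushoutSequence_shortExact α v) (toPushoutSequence α v)
    have hnat' : (kernelClass.{w} α).comp (Ext.mk₀ v) (add_zero 1) =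
      (pushoutSequence_shortExact α v).extClass := hnat.trans (Ext.mk₀_id_comp _)
    rw [← Ext.mk₀_comp_mk₀, ← Ext.mk₀_comp_mk₀, ← Ext.comp_assoc_of_third_deg_zero
      (kernelClass α), hnat', Ext.mk₀_comp_mk₀,
      ← Ext.mk₀_comp_mk₀_assoc,
      (pushoutSequence_shortExact α v).comp_extClass_assoc, Ext.comp_zero])
  have hσ : (pushout.inl (kernel.ι α) v ≫ s) ≫ α = α := by
    rw [Category.assoc, hs]
    exact pushout.inl_desc _ _ _
  have := hα _ hσ
  obtain ⟨r, hr⟩ := exists_kernel_restriction (α := α) (inv (pushout.inl (kernel.ι α) v ≫ s))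
    (by rw [IsIso.inv_comp_eq, hσ])
  -- `v ≫ p` is the restriction to kernels of the automorphism `pushout.inl _ _ ≫ s`, and `r`
  -- restricts its inverse, so `v` is a split monomorphism.
  let p : (⨁ fun _ : Fin n => K) ⟶ kernel α :=
    kernel.lift α (pushout.inr (kernel.ι α) v ≫ s) (by rw [Category.assoc, hs]; exact pushout.inr_desc _ _ _)
  refine ⟨n, ⟨⟨v, p ≫ r, ?_⟩⟩⟩
  rw [← cancel_mono (kernel.ι α), Category.assoc, Category.assoc, hr, kernel.lift_ι_assoc,
    Category.assoc, ← pushout.condition_assoc]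
  rw [← Category.assoc (pushout.inl _ _), IsIso.hom_inv_id, Category.comp_id, Category.id_comp]

theorem surjective_connectingMap_iff (hγ : IsPerfect γ) (hE : IsInjectiveCogenerator k E) :
    LinearMap.range (connectingMap.{w} (kernelSequence_shortExact α) K) = ⊤ ↔
      LinearMap.range (homMap C α) = projTrivialSubmodule C Y := by
  constructor
  · intro h
    ext g
    constructor
    · intro hg
      refine (hγ.left_iff Y g).1 fun y => ?_
      have hy : y ∈ LinearMap.range (connectingMap.{w} (kernelSequence_shortExact α) K) :=
        h ▸ Submodule.mem_top
      obtain ⟨f, rfl⟩ := hy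
      exact (congrArg γ ((hγ.factors_iff hE g).1 hg f)).trans (map_zero γ)
    · intro hg
      exact hg α
  · intro h
    -- The image of the connecting map, taken over `k` because `E` separates only `k`-submodules.
    let N : Submodule k (Ext.{w} Y K 1) :=
      LinearMap.range (((Ext.bilinearCompOfLinear k Y (kernel α) K 1 0 1 (add_zero 1)
        (kernelClass.{w} α)) ∘ₗ (Ext.linearEquiv₀ (R := k)).symm.toLinearMap))
    have hN (y) (hy : y ∈ N) : y ∈
        LinearMap.range (connectingMap.{w} (kernelSequence_shortExact α) K) := by
      obtain ⟨f, rfl⟩ := hy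
      exact ⟨f, by simp [connectingMap]⟩
    refine eq_top_iff.2 fun y _ => hN y ?_
    by_contra hy
    obtain ⟨φ, hφN, hφ⟩ := hE.exists_separating N hy
    -- As `φ` kills the image, `g` is orthogonal to it and lifts along `α`; by assumption `g` is
    -- then projectively trivial, which forces `φ = 0`.
    obtain ⟨g, hg⟩ := hγ.exists_left Y φ
    have hgα : g ∈ LinearMap.range (homMap C α) := by
      refine (factors_iff_comp_kernelClass_eq_zero.{w} α g).2 ?_
      by_contra hne
      obtain ⟨ψ, hψ⟩ := hE.exists_apply_ne_zero hne
      obtain ⟨f, hf⟩ := hγ.exists_right _ ψ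
      apply hψ
      rw [← hf, Ext.comp_assoc_of_third_deg_zero, hg]
      exact hφN _ ⟨f, by simp⟩
    rw [h] at hgα
    exact hφ ((hg y).symm.trans ((hγ.left_iff Y g).2 hgα y))

end IsPerfect

/-- An endomorphism compatible with the connecting map is induced by some `s` on Ker α. Testing
against morphisms to `K` shows that `s` fixes the kernel class, so `s` is invertible. -/
theorem InAdd.linearRightMinimal_connectingMap {K X Y : A} {α : X ⟶ Y} [Epi α]
    (h : InAdd K (kernel α)) (hα : RightMinimal α) :
    LinearRightMinimal (connectingMap.{w} (kernelSequence_shortExact α) K) := by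
  intro c hc
  obtain ⟨s, hs⟩ := h.exists_hom_of_linearMap c
  have : IsIso s := by
    refine isIso_of_kernelClass_comp_eq.{w} α hα s (sub_eq_zero.1 (h.ext_eq_zero _ fun f => ?_))
    have hf := LinearMap.congr_fun hc f
    rw [LinearMap.comp_apply] at hf
    erw [hs f] at hf
    rw [sub_eq_add_neg, Ext.add_comp, Ext.neg_comp, ← sub_eq_add_neg, Ext.comp_assoc_of_third_deg_zero, Ext.mk₀_comp_mk₀, sub_eq_zero]
    exact hf
  refine ⟨fun f g hfg => ?_, fun f => ⟨inv s ≫ f, ?_⟩⟩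
  · have : s ≫ f = s ≫ g := by rw [← hs, ← hs]; exact hfg
    exact (cancel_epi s).1 this
  · exact (hs _).trans (IsIso.hom_inv_id_assoc s f)

end Duality

/-- Projectively trivial morphisms always lift along the epimorphism `α`, so only one inclusion is
at stake. -/
theorem eta_epiClass_eq_bot_iff {A : Type u₁} [Category.{v₁} A] [Abelian A] (C : A) {X Y : A}
    (α : X ⟶ Y) [Epi α] : eta C Y (epiClass α) = ⊥ ↔
      LinearMap.range (homMap C α) = projTrivialSubmodule C Y := by
  change (LinearMap.range (homMap C α)).map (projTrivialSubmodule C Y).mkQ = ⊥ ↔ _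
  rw [← le_bot_iff, Submodule.map_le_iff_le_comap, Submodule.comap_bot, Submodule.ker_mkQ]
  exact ⟨fun h => le_antisymm h fun g hg => hg α, fun h => h.le⟩

end AuslanderBijection

theorem proposition5p1
    {k : Type u} [CommRing k] [IsArtinianRing k]
    {E : Type u} [AddCommGroup E] [Module k E] (hE : IsMinimalInjectiveCogenerator k E)
    {A : Type u₁} [Category.{v₁} A] [Abelian A] [Linear k A] [HasExt.{w} A]
    (hfin : ∀ X Y : A, Module.Finite k (X ⟶ Y))
    (D : ARDuality k E A) (K Y C : A)
    (hC : Nonempty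
      ((projIdeal A).proj.obj C ≅ D.τ.inverse.obj ((injIdeal A).proj.obj K)))
    {X : A} (α : X ⟶ Y) [Epi α] (hα : RightMinimal α) :
    List.TFAE
      [RightDetermined C α ∧ eta C Y (epiClass α) = ⊥,
       InAdd K (kernel α) ∧ LinearMap.range (homMap C α) = projTrivialSubmodule C Y,
       IsUniversalExtension K (kernelSequence_shortExact α)] := by
  obtain ⟨γ, hγ⟩ := D.exists_isPerfect hC
  have := hfin (kernel α) K
  have := hfin C Y
  tfae_have 1 ↔ 2 := by
    rw [eta_epiClass_eq_bot_iff]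
    exact and_congr_left fun _ => ⟨hγ.inAdd_kernel hE.1 hα, hγ.rightDetermined hE.1⟩
  tfae_have 2 → 3 := fun ⟨h, h'⟩ =>
    ⟨hγ.fg_top_ext hE.1 Y, h, (hγ.surjective_connectingMap_iff hE.1).2 h',
      h.linearRightMinimal_connectingMap hα⟩
  tfae_have 3 → 2 := fun h => ⟨h.inAdd, (hγ.surjective_connectingMap_iff hE.1).1 h.range_eq⟩
  tfae_finish
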